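/- Let $p\ge 1$, let $\rho>0$, let $\widehat\Sigma\in\mathbb R^{p\times p}$ be symmetric positive semidefinite with positive semidefinite square root $\widehat\Sigma^{1/2}$, and let $\mathcal X$ be any set of symmetric positive definite $p\times p$ matrices. Write $A\succeq B$ ($A\succ B$) if $A-B$ is symmetric positive semidefinite (positive definite), $\langle A,B\rangle=\operatorname{Tr}(A^\top B)$, and let $$\mathbb W(\mathbb P_1,\mathbb P_2)=\inf_{\Pi}\Big(\int\|\xi_1-\xi_2\|^2\,\Pi(\mathrm d\xi_1,\mathrm d\xi_2)\Big)^{1/2}$$ be the type-2 Wasserstein distance, where $\Pi$ runs over all joint distributions on $\mathbb R^p\times\mathbb R^p$ with marginals $\mathbb P_1,\mathbb P_2$ and $\|\cdot\|$ is the Euclidean norm. Let $\mathcal P^0$ be the set of all (possibly degenerate) normal distributions $\mathbb Q=\mathcal N(0,S)$, $S\succeq 0$, on $\mathbb R^p$ with $\mathbb W(\mathbb Q,\mathcal N(0,\widehat\Sigma))\le\rho$. Then the optimal value of the simplified distributionally robust estimation problem $$\mathcal J(\widehat\Sigma)=\inf_{X\in\mathcal X}\Big\{-\log\det X+\sup_{\mathbb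 Q\in\mathcal P^0}\mathbb E^{\mathbb Q}\big[\langle \xi\xi^\top,X\rangle\big]\Big\}$$ equals the optimal value of the semidefinite program $$\begin{array}{cl}\displaystyle\inf_{X,Y,\gamma}&-\log\det X+\gamma\big(\rho^2-\operatorname{Tr}\widehat\Sigma\big)+\operatorname{Tr}Y\\[1mm]\text{s.t.}&\begin{bmatrix}Y&\gamma\widehat\Sigma^{1/2}\\ \gamma\widehat\Sigma^{1/2}&\gamma I-X\end{bmatrix}\succeq0,\qquad \gamma I\succ X\succ0,\quad Y\succeq0,\quad X\in\mathcal X,\end{array}$$ where $X,Y$ range over $p\times p$ matrices and $\gamma$ over $\mathbb R$. Moreover, the two problems are equivalent in the variable $X$: for every fixed $X\in\mathcal X$, the objective value of $X$ in the first problem equals the infimum of the objective of the semidefinite program over all $(Y,\gamma)$ for which $(X,Y,\gamma)$ is feasible. (All infima and suprema are taken in $[-\infty,\infty]$, with $\inf\emptyset=\infty$.) -/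

import Mathlib

namespace WassersteinDRO

open MeasureTheory ProbabilityTheory
open scoped Matrix MatrixOrder

/-- The couplings of `P₁` and `P₂`: the joint laws on `ℝᵖ × ℝᵖ` with marginals `P₁` and `P₂`. -/
def couplings {p : ℕ} (P₁ P₂ : Measure (EuclideanSpace ℝ (Fin p))) :
    Set (Measure (EuclideanSpace ℝ (Fin p) × EuclideanSpace ℝ (Fin p))) :=
  {π | π.map Prod.fst = P₁ ∧ π.map Prod.snd = P₂}

/-- The type-2 Wasserstein distance
`inf_π (∫ ‖ξ₁ - ξ₂‖² dπ(ξ₁, ξ₂))^(1/2)` for the Euclidean norm on `ℝᵖ`, as an extended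
nonnegative real. -/
noncomputable def wasserstein {p : ℕ} (P₁ P₂ : Measure (EuclideanSpace ℝ (Fin p))) : ENNReal :=
  ⨅ π ∈ couplings P₁ P₂, (∫⁻ z, ‖z.1 - z.2‖ₑ ^ 2 ∂π) ^ (1 / 2 : ℝ)

/-- The zero-mean normal distributions on `ℝᵖ`, with arbitrary (possibly singular) positive
semidefinite covariance matrix. -/
def centeredNormals (p : ℕ) : Set (Measure (EuclideanSpace ℝ (Fin p))) :=
  {Q | ∃ S : Matrix (Fin p) (Fin p) ℝ, S.PosSemidef ∧ Q = multivariateGaussian 0 S}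

/-- The zero-mean normal distributions within Wasserstein distance `ρ` of `N(0, Sig)`. -/
def ambiguitySet {p : ℕ} (ρ : ℝ) (Sig : Matrix (Fin p) (Fin p) ℝ) :
    Set (Measure (EuclideanSpace ℝ (Fin p))) :=
  {Q | Q ∈ centeredNormals p ∧ wasserstein Q (multivariateGaussian 0 Sig) ≤ ENNReal.ofReal ρ}

/-- The worst-case expectation `sup_Q E^Q[⟨ξξᵀ, X⟩]` over the ambiguity set, where
`⟨A, B⟩ = Tr(AᵀB)`. The supremum is taken in `[-∞, ∞]`. -/
noncomputable def worstCase {p : ℕ} (ρ : ℝ) (Sig X : Matrix (Fin p) (Fin p) ℝ) : EReal :=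
  ⨆ Q ∈ ambiguitySet ρ Sig,
    ((∫ ξ, ((Matrix.vecMulVec ξ.ofLp ξ.ofLp)ᵀ * X).trace ∂Q : ℝ) : EReal)

/-- The objective function `-log det X + sup_Q E^Q[⟨ξξᵀ, X⟩]` of the simplified distributionally
robust estimation problem. -/
noncomputable def droObjective {p : ℕ} (ρ : ℝ) (Sig X : Matrix (Fin p) (Fin p) ℝ) : EReal :=
  ((-Real.log X.det : ℝ) : EReal) + worstCase ρ Sig X

/-- The optimal value `J(Sig)` of the simplified distributionally robust estimation problem over
the admissible precision matrices `𝒳`. -/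
noncomputable def droValue {p : ℕ} (ρ : ℝ) (Sig : Matrix (Fin p) (Fin p) ℝ)
    (𝒳 : Set (Matrix (Fin p) (Fin p) ℝ)) : EReal :=
  ⨅ X ∈ 𝒳, droObjective ρ Sig X

/-- The constraints of the semidefinite program on the decision variables `X`, `Y`, `γ`. Here
`CFC.sqrt Sig` is the positive semidefinite square root of `Sig`. -/
structure SDPFeasible {p : ℕ} (Sig : Matrix (Fin p) (Fin p) ℝ)
    (𝒳 : Set (Matrix (Fin p) (Fin p) ℝ)) (X Y : Matrix (Fin p) (Fin p) ℝ) (γ : ℝ) : Prop where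
  lmi : (Matrix.fromBlocks Y (γ • CFC.sqrt Sig) (γ • CFC.sqrt Sig)
    (γ • (1 : Matrix (Fin p) (Fin p) ℝ) - X)).PosSemidef
  upper : (γ • (1 : Matrix (Fin p) (Fin p) ℝ) - X).PosDef
  pos : X.PosDef
  nonneg : Y.PosSemidef
  mem : X ∈ 𝒳

/-- The objective function of the semidefinite program. -/
noncomputable def sdpObjective {p : ℕ} (ρ : ℝ) (Sig X Y : Matrix (Fin p) (Fin p) ℝ) (γ : ℝ) : ℝ :=
  -Real.log X.det + γ * (ρ ^ 2 - Sig.trace) + Y.trace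

/-- The infimum over `Y` and `γ` of the semidefinite program for a fixed `X` (equal to `∞` if
no feasible `Y`, `γ` exist). -/
noncomputable def sdpPartialValue {p : ℕ} (ρ : ℝ) (Sig : Matrix (Fin p) (Fin p) ℝ)
    (𝒳 : Set (Matrix (Fin p) (Fin p) ℝ)) (X : Matrix (Fin p) (Fin p) ℝ) : EReal :=
  ⨅ (Y : Matrix (Fin p) (Fin p) ℝ) (γ : ℝ) (_ : SDPFeasible Sig 𝒳 X Y γ),
    (sdpObjective ρ Sig X Y γ : EReal)

/-- The optimal value of the semidefinite program: the infimum over `X`, `Y` and `γ`. -/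
noncomputable def sdpValue {p : ℕ} (ρ : ℝ) (Sig : Matrix (Fin p) (Fin p) ℝ)
    (𝒳 : Set (Matrix (Fin p) (Fin p) ℝ)) : EReal :=
  ⨅ (X : Matrix (Fin p) (Fin p) ℝ) (Y : Matrix (Fin p) (Fin p) ℝ) (γ : ℝ)
    (_ : SDPFeasible Sig 𝒳 X Y γ), (sdpObjective ρ Sig X Y γ : EReal)

end WassersteinDRO

namespace WassersteinDRO

open MeasureTheory ProbabilityTheory
open scoped Matrix MatrixOrder

variable {p : ℕ}

/-! For fixed `X`, both sides equal the infimum over `γ` with `γI - X ≻ 0` of the Lagrangian dual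
function `dualValue`. On the SDP side this is a Schur complement: the cheapest `Y` is `γ² Σ^{1/2}
(γI - X)⁻¹ Σ^{1/2}`. On the Wasserstein side, weak duality integrates a pointwise quadratic bound
against a coupling (`dotProduct_mulVec_le`, `trace_le_dualValue`). That bound is tight along `x = T
y` with `T = γ(γI - X)⁻¹`, so the near-optimal law is that of `T y` plus independent Gaussian noise
along a maximizing direction `v` of the quadratic form of `X`, the noise spending whatever budget
`T` leaves. With `l` the maximum of the form on the unit sphere, the duality gap is `(γ - l)` times
that leftover; it is zero if the cost of `T` can be tuned to `ρ²`, and otherwise small for `γ` near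
`l` (`exists_dualValue_sub_le`). -/

/-! ### Second moments and linear images of centered Gaussians -/

theorem trace_transpose_vecMulVec_mul (A : Matrix (Fin p) (Fin p) ℝ) (x : Fin p → ℝ) :
    ((Matrix.vecMulVec x x)ᵀ * A).trace = x ⬝ᵥ A *ᵥ x := by
  rw [Matrix.transpose_vecMulVec, Matrix.vecMulVec_mul, Matrix.trace_vecMulVec,
    Matrix.dotProduct_mulVec, dotProduct_comm]

theorem dotProduct_mulVec_eq_sum (A : Matrix (Fin p) (Fin p) ℝ) (x : Fin p → ℝ) :
    x ⬝ᵥ A *ᵥ x = ∑ i, ∑ j, A i j * (x i * x j) := by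
  simp only [dotProduct, Matrix.mulVec, Finset.mul_sum]
  exact Finset.sum_congr rfl fun i _ => Finset.sum_congr rfl fun j _ => by ring

theorem norm_sq_eq_dotProduct (x : EuclideanSpace ℝ (Fin p)) :
    ‖x‖ ^ 2 = x.ofLp ⬝ᵥ x.ofLp := by
  rw [EuclideanSpace.real_norm_sq_eq]
  exact Finset.sum_congr rfl fun i _ => by ring

theorem memLp_two_eval {S : Matrix (Fin p) (Fin p) ℝ} (i : Fin p) :
    MemLp (fun x : EuclideanSpace ℝ (Fin p) => x i) 2 (multivariateGaussian 0 S) := by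
  have h : MemLp (id : EuclideanSpace ℝ (Fin p) → _) 2 (multivariateGaussian 0 S) :=
    IsGaussian.memLp_two_id
  exact (EuclideanSpace.proj (𝕜 := ℝ) i).comp_memLp' h

theorem integrable_dotProduct_mulVec (S A : Matrix (Fin p) (Fin p) ℝ) :
    Integrable (fun x : EuclideanSpace ℝ (Fin p) => x.ofLp ⬝ᵥ A *ᵥ x.ofLp)
      (multivariateGaussian 0 S) := by
  simp only [dotProduct_mulVec_eq_sum]
  exact integrable_finsetSum _ fun i _ => integrable_finsetSum _ fun j _ =>
    ((memLp_two_eval i).integrable_mul (memLp_two_eval j)).const_mul _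

theorem integral_eval_mul_eval {S : Matrix (Fin p) (Fin p) ℝ} (hS : S.PosSemidef) (i j : Fin p) :
    ∫ x : EuclideanSpace ℝ (Fin p), x i * x j ∂multivariateGaussian 0 S = S i j := by
  have hmean (k : Fin p) : ∫ x : EuclideanSpace ℝ (Fin p), x k ∂multivariateGaussian 0 S = 0 := by
    have := (EuclideanSpace.proj (𝕜 := ℝ) k).integral_comp_id_comm
      (μ := multivariateGaussian (0 : EuclideanSpace ℝ (Fin p)) S) IsGaussian.integrable_id
    simpa using this
  rw [← covariance_eval_multivariateGaussian (μ := 0) hS i j,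
    covariance_eq_sub (memLp_two_eval i) (memLp_two_eval j)]
  simp [hmean]

theorem integral_dotProduct_mulVec {S : Matrix (Fin p) (Fin p) ℝ} (hS : S.PosSemidef)
    (A : Matrix (Fin p) (Fin p) ℝ) :
    ∫ x : EuclideanSpace ℝ (Fin p), x.ofLp ⬝ᵥ A *ᵥ x.ofLp ∂multivariateGaussian 0 S
      = (S * A).trace := by
  have hint (i j : Fin p) : Integrable (fun x : EuclideanSpace ℝ (Fin p) => A i j * (x i * x j))
      (multivariateGaussian 0 S) :=
    ((memLp_two_eval i).integrable_mul (memLp_two_eval j)).const_mul _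
  simp only [dotProduct_mulVec_eq_sum]
  rw [integral_finsetSum _ fun i _ => integrable_finsetSum _ fun j _ => hint i j]
  simp_rw [integral_finsetSum _ fun j _ => hint _ j, integral_const_mul, integral_eval_mul_eval hS]
  rw [Finset.sum_comm]
  simp only [Matrix.trace, Matrix.diag, Matrix.mul_apply]
  refine Finset.sum_congr rfl fun i _ => Finset.sum_congr rfl fun j _ => ?_
  have := hS.isHermitian.apply i j
  simp only [star_trivial] at this
  rw [this, mul_comm]

theorem integrable_norm_sq (S : Matrix (Fin p) (Fin p) ℝ) :
    Integrable (fun x : EuclideanSpace ℝ (Fin p) => ‖x‖ ^ 2) (multivariateGaussian 0 S) := by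
  simpa [norm_sq_eq_dotProduct] using integrable_dotProduct_mulVec S 1

theorem integral_norm_sq {S : Matrix (Fin p) (Fin p) ℝ} (hS : S.PosSemidef) :
    ∫ x : EuclideanSpace ℝ (Fin p), ‖x‖ ^ 2 ∂multivariateGaussian 0 S = S.trace := by
  simpa [norm_sq_eq_dotProduct] using integral_dotProduct_mulVec hS 1

/-- The law of `M x + y` for independent centered normal vectors `x` and `y`. -/
theorem map_prod_multivariateGaussian (M : Matrix (Fin p) (Fin p) ℝ)
    {A B : Matrix (Fin p) (Fin p) ℝ} (hA : A.PosSemidef) (hB : B.PosSemidef) :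
    ((multivariateGaussian 0 A).prod (multivariateGaussian 0 B)).map
      (fun z => Matrix.toEuclideanCLM (𝕜 := ℝ) M z.1 + z.2)
      = multivariateGaussian 0 (M * A * Mᵀ + B) := by
  have hMA : (M * A * Mᵀ).PosSemidef := by
    simpa using hA.mul_mul_conjTranspose_same M
  set L := Matrix.toEuclideanCLM (𝕜 := ℝ) M with hL
  have hconv : ((multivariateGaussian 0 A).prod (multivariateGaussian 0 B)).map
      (fun z => L z.1 + z.2)
      = ((multivariateGaussian 0 A).map L).conv (multivariateGaussian 0 B) := by
    rw [Measure.conv]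
    conv_rhs => rw [← Measure.map_id (μ := multivariateGaussian 0 B)]
    rw [Measure.map_prod_map _ _ (by fun_prop) measurable_id,
      Measure.map_map (by fun_prop) (by fun_prop)]
    rfl
  rw [hconv]
  refine Measure.ext_of_charFun ?_
  ext t
  have hmap : charFun ((multivariateGaussian 0 A).map L) t
      = charFun (multivariateGaussian 0 A) (ContinuousLinearMap.adjoint L t) := by
    rw [charFun_apply, charFun_apply, integral_map (by fun_prop) (by fun_prop)]
    simp_rw [ContinuousLinearMap.adjoint_inner_right]
  have hadj : (ContinuousLinearMap.adjoint L t).ofLp = Mᵀ *ᵥ t.ofLp := by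
    have : ContinuousLinearMap.adjoint L = Matrix.toEuclideanCLM (𝕜 := ℝ) Mᵀ := by
      rw [hL, ← ContinuousLinearMap.star_eq_adjoint, ← map_star, Matrix.star_eq_conjTranspose,
        Matrix.conjTranspose_eq_transpose_of_trivial]
    rw [this, Matrix.ofLp_toEuclideanCLM]
  rw [charFun_conv, hmap, charFun_multivariateGaussian hA, charFun_multivariateGaussian hB,
    charFun_multivariateGaussian (hMA.add hB), ← Complex.exp_add, hadj]
  congr 1
  have : (Mᵀ *ᵥ t.ofLp) ⬝ᵥ A *ᵥ (Mᵀ *ᵥ t.ofLp) = t.ofLp ⬝ᵥ (M * A * Mᵀ) *ᵥ t.ofLp := by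
    rw [Matrix.mulVec_transpose, ← Matrix.dotProduct_mulVec, ← Matrix.mulVec_transpose,
      Matrix.mulVec_mulVec, Matrix.mulVec_mulVec, Matrix.mul_assoc]
  rw [this, Matrix.add_mulVec, dotProduct_add]
  simp
  ring

/-! ### Weak duality -/

/-- The dual objective of the worst-case expectation problem, with the multiplier `γ` of the
Wasserstein constraint. -/
noncomputable def dualValue (ρ : ℝ) (Sig X : Matrix (Fin p) (Fin p) ℝ) (γ : ℝ) : ℝ :=
  γ * (ρ ^ 2 - Sig.trace) + γ ^ 2 * (Sig * (γ • (1 : Matrix (Fin p) (Fin p) ℝ) - X)⁻¹).trace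

/-- With `D = γI - X`, this is `(x - γD⁻¹y)ᵀ D (x - γD⁻¹y) ≥ 0` expanded; equality holds at `x =
γD⁻¹y`. -/
theorem dotProduct_mulVec_le {X : Matrix (Fin p) (Fin p) ℝ} {γ : ℝ}
    (hD : (γ • (1 : Matrix (Fin p) (Fin p) ℝ) - X).PosDef) (x y : EuclideanSpace ℝ (Fin p)) :
    x.ofLp ⬝ᵥ X *ᵥ x.ofLp ≤ γ * ‖x - y‖ ^ 2 +
      (γ ^ 2 * (y.ofLp ⬝ᵥ (γ • (1 : Matrix (Fin p) (Fin p) ℝ) - X)⁻¹ *ᵥ y.ofLp)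
        - γ * ‖y‖ ^ 2) := by
  set D := γ • (1 : Matrix (Fin p) (Fin p) ℝ) - X with hDdef
  have hX : X = γ • 1 - D := by rw [hDdef]; abel
  have hDT : Dᵀ = D := by simpa using hD.isHermitian.eq
  set w := D⁻¹ *ᵥ y.ofLp with hw
  have hDw : D *ᵥ w = y.ofLp := by
    rw [hw, Matrix.mulVec_mulVec,
      Matrix.mul_nonsing_inv _ ((Matrix.isUnit_iff_isUnit_det _).1 hD.isUnit),
      Matrix.one_mulVec]
  have hwD (v : Fin p → ℝ) : w ⬝ᵥ D *ᵥ v = y.ofLp ⬝ᵥ v := by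
    rw [Matrix.dotProduct_mulVec, ← Matrix.mulVec_transpose, hDT, hDw]
  have h0 := hD.posSemidef.dotProduct_mulVec_nonneg (x.ofLp - γ • w)
  simp only [star_trivial, Matrix.mulVec_sub, Matrix.mulVec_smul, hDw, sub_dotProduct,
    dotProduct_sub, smul_dotProduct, dotProduct_smul, hwD, smul_eq_mul] at h0
  rw [norm_sq_eq_dotProduct, norm_sq_eq_dotProduct, hX, Matrix.sub_mulVec, Matrix.smul_mulVec,
    Matrix.one_mulVec]
  simp only [WithLp.ofLp_sub, sub_dotProduct, dotProduct_sub, dotProduct_smul, smul_eq_mul]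
  rw [dotProduct_comm y.ofLp x.ofLp] at *
  rw [dotProduct_comm w y.ofLp] at h0
  nlinarith [h0]

theorem integral_le_of_mem_couplings {S Sig X : Matrix (Fin p) (Fin p) ℝ} {γ r : ℝ}
    (hS : S.PosSemidef) (hSig : Sig.PosSemidef) (hγ : 0 ≤ γ) (hr : 0 ≤ r)
    (hD : (γ • (1 : Matrix (Fin p) (Fin p) ℝ) - X).PosDef)
    {π : Measure (EuclideanSpace ℝ (Fin p) × EuclideanSpace ℝ (Fin p))}
    (hπ : π ∈ couplings (multivariateGaussian 0 S) (multivariateGaussian 0 Sig))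
    (hcost : ∫⁻ z, ‖z.1 - z.2‖ₑ ^ 2 ∂π ≤ ENNReal.ofReal r) :
    (S * X).trace ≤ γ * (r - Sig.trace)
      + γ ^ 2 * (Sig * (γ • (1 : Matrix (Fin p) (Fin p) ℝ) - X)⁻¹).trace := by
  obtain ⟨h1, h2⟩ := hπ
  have e1 := integral_map (μ := π) (f := fun x : EuclideanSpace ℝ (Fin p) => x.ofLp ⬝ᵥ X *ᵥ x.ofLp)
    measurable_fst.aemeasurable (h1 ▸ (integrable_dotProduct_mulVec S X).aestronglyMeasurable)
  have i1 := (h1 ▸ integrable_dotProduct_mulVec S X :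
    Integrable (fun x : EuclideanSpace ℝ (Fin p) => x.ofLp ⬝ᵥ X *ᵥ x.ofLp)
      (π.map Prod.fst)).comp_measurable measurable_fst
  set g : EuclideanSpace ℝ (Fin p) → ℝ := fun y =>
    γ ^ 2 * (y.ofLp ⬝ᵥ (γ • (1 : Matrix (Fin p) (Fin p) ℝ) - X)⁻¹ *ᵥ y.ofLp) - γ * ‖y‖ ^ 2
    with hg
  have hgi : Integrable g (multivariateGaussian 0 Sig) :=
    ((integrable_dotProduct_mulVec Sig _).const_mul _).sub ((integrable_norm_sq Sig).const_mul _)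
  have e2 := integral_map (μ := π) (f := g)
    measurable_snd.aemeasurable (h2 ▸ hgi.aestronglyMeasurable)
  have i2 := (h2 ▸ hgi : Integrable g (π.map Prod.snd)).comp_measurable measurable_snd
  have hgint : ∫ y, g y ∂multivariateGaussian 0 Sig
      = γ ^ 2 * (Sig * (γ • (1 : Matrix (Fin p) (Fin p) ℝ) - X)⁻¹).trace - γ * Sig.trace := by
    rw [hg, integral_sub ((integrable_dotProduct_mulVec Sig _).const_mul _)
      ((integrable_norm_sq Sig).const_mul _), integral_const_mul, integral_const_mul,
      integral_dotProduct_mulVec hSig, integral_norm_sq hSig]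
  rw [h1, integral_dotProduct_mulVec hS] at e1
  rw [h2, hgint] at e2
  have hen : ∀ z : EuclideanSpace ℝ (Fin p) × EuclideanSpace ℝ (Fin p),
      ‖z.1 - z.2‖ₑ ^ 2 = ENNReal.ofReal (‖z.1 - z.2‖ ^ 2) := fun z => by
    rw [← ofReal_norm, ENNReal.ofReal_pow (norm_nonneg _)]
  simp_rw [hen] at hcost
  have hm : AEStronglyMeasurable (fun z : EuclideanSpace ℝ (Fin p) × EuclideanSpace ℝ (Fin p) =>
      ‖z.1 - z.2‖ ^ 2) π := by
    exact (by fun_prop : Measurable _).aestronglyMeasurable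
  have hnn : 0 ≤ᵐ[π] (fun z => ‖z.1 - z.2‖ ^ 2) := .of_forall fun z => by positivity
  have i3 : Integrable (fun z : EuclideanSpace ℝ (Fin p) × EuclideanSpace ℝ (Fin p) =>
      ‖z.1 - z.2‖ ^ 2) π :=
    ⟨hm, (hasFiniteIntegral_iff_ofReal hnn).2 (hcost.trans_lt ENNReal.ofReal_lt_top)⟩
  have e3 : ∫ z, ‖z.1 - z.2‖ ^ 2 ∂π ≤ r := by
    rw [integral_eq_lintegral_of_nonneg_ae hnn hm]
    exact ENNReal.toReal_le_of_le_ofReal hr hcost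
  calc (S * X).trace = ∫ z, z.1.ofLp ⬝ᵥ X *ᵥ z.1.ofLp ∂π := e1
    _ ≤ ∫ z, (γ * ‖z.1 - z.2‖ ^ 2 + g z.2) ∂π :=
        integral_mono i1 ((i3.const_mul γ).add i2) fun z => dotProduct_mulVec_le hD z.1 z.2
    _ = γ * ∫ z, ‖z.1 - z.2‖ ^ 2 ∂π + ∫ z, g z.2 ∂π := by
        rw [← integral_const_mul]
        exact integral_add (i3.const_mul γ) i2
    _ ≤ γ * r + ∫ z, g z.2 ∂π := by gcongr
    _ = _ := by rw [← e2]; ring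

/-- Slack `r > ρ` avoids proving that an optimal coupling exists. -/
theorem exists_coupling_of_wasserstein_le {P₁ P₂ : Measure (EuclideanSpace ℝ (Fin p))} {ρ r : ℝ}
    (hρ : 0 ≤ ρ) (h : wasserstein P₁ P₂ ≤ ENNReal.ofReal ρ) (hr : ρ < r) :
    ∃ π ∈ couplings P₁ P₂, ∫⁻ z, ‖z.1 - z.2‖ₑ ^ 2 ∂π ≤ ENNReal.ofReal (r ^ 2) := by
  have hlt : wasserstein P₁ P₂ < ENNReal.ofReal r :=
    h.trans_lt ((ENNReal.ofReal_lt_ofReal_iff (hρ.trans_lt hr)).2 hr)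
  simp only [wasserstein, iInf_lt_iff] at hlt
  obtain ⟨π, hπ, hlt⟩ := hlt
  refine ⟨π, hπ, ?_⟩
  have := ENNReal.rpow_le_rpow hlt.le (zero_le_two : (0 : ℝ) ≤ 2)
  rw [← ENNReal.rpow_mul] at this
  rw [ENNReal.ofReal_pow (hρ.trans hr.le)]
  simpa using this

/-- Weak duality for the worst-case expectation over the ambiguity set. -/
theorem trace_le_dualValue {S Sig X : Matrix (Fin p) (Fin p) ℝ} {γ ρ : ℝ}
    (hS : S.PosSemidef) (hSig : Sig.PosSemidef) (hγ : 0 ≤ γ) (hρ : 0 ≤ ρ)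
    (hD : (γ • (1 : Matrix (Fin p) (Fin p) ℝ) - X).PosDef)
    (h : wasserstein (multivariateGaussian 0 S) (multivariateGaussian 0 Sig)
      ≤ ENNReal.ofReal ρ) :
    (S * X).trace ≤ dualValue ρ Sig X γ := by
  have key : ∀ r ∈ Set.Ioi ρ, (S * X).trace ≤ dualValue r Sig X γ := fun r hr => by
    obtain ⟨π, hπ, hcost⟩ := exists_coupling_of_wasserstein_le hρ h hr
    exact integral_le_of_mem_couplings hS hSig hγ (sq_nonneg r) hD hπ hcost
  -- The slack is removed by letting `r ↓ ρ`.
  have hc : Continuous fun r => dualValue r Sig X γ := by unfold dualValue; fun_prop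
  exact ge_of_tendsto (hc.continuousWithinAt (s := Set.Ioi ρ) (x := ρ))
    (Filter.eventually_of_mem self_mem_nhdsWithin key)

/-! ### Elimination of `Y` by the Schur complement -/

theorem lmi_iff {Sig X Y : Matrix (Fin p) (Fin p) ℝ} {γ : ℝ}
    (hD : (γ • (1 : Matrix (Fin p) (Fin p) ℝ) - X).PosDef) :
    (Matrix.fromBlocks Y (γ • CFC.sqrt Sig) (γ • CFC.sqrt Sig)
      (γ • (1 : Matrix (Fin p) (Fin p) ℝ) - X)).PosSemidef ↔
    (Y - (γ • CFC.sqrt Sig) * (γ • (1 : Matrix (Fin p) (Fin p) ℝ) - X)⁻¹ *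
      (γ • CFC.sqrt Sig)).PosSemidef := by
  have hsym : (γ • CFC.sqrt Sig)ᴴ = γ • CFC.sqrt Sig := by
    rw [Matrix.conjTranspose_smul, star_trivial,
      (Matrix.nonneg_iff_posSemidef.1 (CFC.sqrt_nonneg Sig)).isHermitian.eq]
  let := hD.isUnit.invertible
  have := Matrix.PosDef.fromBlocks₂₂ Y (γ • CFC.sqrt Sig) hD
  rwa [hsym] at this

theorem trace_smul_sqrt_mul_mul_smul_sqrt {Sig : Matrix (Fin p) (Fin p) ℝ}
    (hSig : Sig.PosSemidef) (γ : ℝ) (A : Matrix (Fin p) (Fin p) ℝ) :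
    ((γ • CFC.sqrt Sig) * A * (γ • CFC.sqrt Sig)).trace = γ ^ 2 * (Sig * A).trace := by
  rw [Matrix.trace_mul_comm, ← mul_assoc, Matrix.smul_mul, Matrix.mul_smul,
    CFC.sqrt_mul_sqrt_self _ hSig.nonneg, smul_smul, Matrix.smul_mul, Matrix.trace_smul,
    smul_eq_mul, sq]

theorem dualValue_le_of_lmi {Sig X Y : Matrix (Fin p) (Fin p) ℝ} {γ : ℝ} (ρ : ℝ)
    (hSig : Sig.PosSemidef) (hD : (γ • (1 : Matrix (Fin p) (Fin p) ℝ) - X).PosDef)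
    (h : (Matrix.fromBlocks Y (γ • CFC.sqrt Sig) (γ • CFC.sqrt Sig)
      (γ • (1 : Matrix (Fin p) (Fin p) ℝ) - X)).PosSemidef) :
    dualValue ρ Sig X γ ≤ γ * (ρ ^ 2 - Sig.trace) + Y.trace := by
  have := ((lmi_iff hD).1 h).trace_nonneg
  rw [Matrix.trace_sub, trace_smul_sqrt_mul_mul_smul_sqrt hSig] at this
  unfold dualValue
  linarith

/-- The optimal `Y` for given `X` and `γ`. -/
theorem exists_lmi_trace_eq {Sig X : Matrix (Fin p) (Fin p) ℝ} {γ : ℝ} (ρ : ℝ)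
    (hSig : Sig.PosSemidef) (hD : (γ • (1 : Matrix (Fin p) (Fin p) ℝ) - X).PosDef) :
    ∃ Y : Matrix (Fin p) (Fin p) ℝ, Y.PosSemidef ∧
      (Matrix.fromBlocks Y (γ • CFC.sqrt Sig) (γ • CFC.sqrt Sig)
        (γ • (1 : Matrix (Fin p) (Fin p) ℝ) - X)).PosSemidef ∧
      γ * (ρ ^ 2 - Sig.trace) + Y.trace = dualValue ρ Sig X γ := by
  refine ⟨(γ • CFC.sqrt Sig) * (γ • (1 : Matrix (Fin p) (Fin p) ℝ) - X)⁻¹ *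
      (γ • CFC.sqrt Sig), ?_, ?_, ?_⟩
  · have := hD.inv.posSemidef.mul_mul_conjTranspose_same (γ • CFC.sqrt Sig)
    rwa [Matrix.conjTranspose_smul, star_trivial,
      (Matrix.nonneg_iff_posSemidef.1 (CFC.sqrt_nonneg Sig)).isHermitian.eq] at this
  · rw [lmi_iff hD, sub_self]
    exact .zero
  · rw [trace_smul_sqrt_mul_mul_smul_sqrt hSig, dualValue]

/-! ### Near-optimal covariances and strong duality -/

theorem exists_unit_isMax_quadratic (hp : 0 < p) (X : Matrix (Fin p) (Fin p) ℝ) :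
    ∃ v : Fin p → ℝ, v ⬝ᵥ v = 1 ∧ ∀ x : Fin p → ℝ, x ⬝ᵥ X *ᵥ x ≤ (v ⬝ᵥ X *ᵥ v) * (x ⬝ᵥ x) := by
  have : Nonempty (Fin p) := ⟨⟨0, hp⟩⟩
  have hc : Continuous fun x : EuclideanSpace ℝ (Fin p) => x.ofLp ⬝ᵥ X *ᵥ x.ofLp := by
    simp only [dotProduct_mulVec_eq_sum]
    fun_prop
  obtain ⟨v, hv, hmax⟩ := (isCompact_sphere (0 : EuclideanSpace ℝ (Fin p)) 1).exists_isMaxOn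
    (NormedSpace.sphere_nonempty.2 zero_le_one) hc.continuousOn
  have hv1 : ‖v‖ = 1 := by simpa using hv
  refine ⟨v.ofLp, by rw [← norm_sq_eq_dotProduct, hv1, one_pow], fun x => ?_⟩
  rcases eq_or_ne x 0 with rfl | hx
  · simp
  have hy : WithLp.toLp 2 x ≠ 0 := by simpa using hx
  have hn : 0 < ‖WithLp.toLp 2 x‖ := norm_pos_iff.2 hy
  have hm := hmax (show ‖WithLp.toLp 2 x‖⁻¹ • WithLp.toLp 2 x ∈ Metric.sphere 0 1 by
    simp [norm_smul, hn.ne'])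
  simp only [Set.mem_ofPred_eq, WithLp.ofLp_smul, Matrix.mulVec_smul, smul_dotProduct,
    dotProduct_smul, smul_eq_mul] at hm
  have hns := norm_sq_eq_dotProduct (WithLp.toLp 2 x)
  simp only at hns
  rw [← hns]
  calc x ⬝ᵥ X *ᵥ x
      = (‖WithLp.toLp 2 x‖⁻¹ * (‖WithLp.toLp 2 x‖⁻¹ * (x ⬝ᵥ X *ᵥ x))) *
        ‖WithLp.toLp 2 x‖ ^ 2 := by field_simp
    _ ≤ _ := by gcongr

theorem posDef_smul_one_sub {X : Matrix (Fin p) (Fin p) ℝ} (hX : X.IsHermitian) {l γ : ℝ}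
    (hl : ∀ x : Fin p → ℝ, x ⬝ᵥ X *ᵥ x ≤ l * (x ⬝ᵥ x)) (hγ : l < γ) :
    (γ • (1 : Matrix (Fin p) (Fin p) ℝ) - X).PosDef := by
  refine .of_dotProduct_mulVec_pos ?_ fun {x} hx => ?_
  · exact ((Matrix.isHermitian_one).smul (IsSelfAdjoint.all γ)).sub hX
  · have hpos : 0 < x ⬝ᵥ x := by
      have := Matrix.PosDef.one (n := Fin p) (R := ℝ) |>.dotProduct_mulVec_pos hx
      simpa using this
    simp only [star_trivial, Matrix.sub_mulVec, Matrix.smul_mulVec, Matrix.one_mulVec,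
      dotProduct_sub, dotProduct_smul, smul_eq_mul]
    nlinarith [hl x]

/-- For independent `y ~ N(0, Sig)` and `w ~ N(0, R)`, couple `T y + w` with `y`: the displacement
`(T - 1) y + w` is Gaussian, and its mean square norm is the trace of its covariance. -/
theorem wasserstein_le_of_map {Sig R : Matrix (Fin p) (Fin p) ℝ} (hSig : Sig.PosSemidef)
    (hR : R.PosSemidef) (T : Matrix (Fin p) (Fin p) ℝ) {ρ : ℝ} (hρ : 0 ≤ ρ)
    (h : ((T - 1) * Sig * (T - 1)ᵀ + R).trace ≤ ρ ^ 2) :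
    wasserstein (multivariateGaussian 0 (T * Sig * Tᵀ + R)) (multivariateGaussian 0 Sig)
      ≤ ENNReal.ofReal ρ := by
  set μ := (multivariateGaussian (0 : EuclideanSpace ℝ (Fin p)) Sig).prod
    (multivariateGaussian (0 : EuclideanSpace ℝ (Fin p)) R)
  set f : EuclideanSpace ℝ (Fin p) × EuclideanSpace ℝ (Fin p) →
      EuclideanSpace ℝ (Fin p) × EuclideanSpace ℝ (Fin p) :=
    fun z => (Matrix.toEuclideanCLM (𝕜 := ℝ) T z.1 + z.2, z.1) with hf
  have hfm : Measurable f := by fun_prop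
  have hS : ((T - 1) * Sig * (T - 1)ᵀ + R).PosSemidef := by
    refine .add ?_ hR
    have := hSig.mul_mul_conjTranspose_same (T - 1)
    rwa [Matrix.conjTranspose_eq_transpose_of_trivial] at this
  have hmem : μ.map f ∈ couplings (multivariateGaussian 0 (T * Sig * Tᵀ + R))
      (multivariateGaussian 0 Sig) := by
    constructor
    · rw [Measure.map_map measurable_fst hfm, ← map_prod_multivariateGaussian T hSig hR]
      rfl
    · rw [Measure.map_map measurable_snd hfm]
      exact (Measure.map_fst_prod (μ := multivariateGaussian (0 : EuclideanSpace ℝ (Fin p)) Sig)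
        (ν := multivariateGaussian (0 : EuclideanSpace ℝ (Fin p)) R)).trans (by simp)
  refine (iInf₂_le _ hmem).trans ?_
  have hcost : ∫⁻ z, ‖z.1 - z.2‖ₑ ^ 2 ∂(μ.map f)
      = ENNReal.ofReal ((T - 1) * Sig * (T - 1)ᵀ + R).trace := by
    rw [lintegral_map (by fun_prop) hfm, ← integral_norm_sq hS,
      ofReal_integral_eq_lintegral_ofReal (integrable_norm_sq _)
        (.of_forall fun _ => by positivity),
      ← map_prod_multivariateGaussian (T - 1) hSig hR, lintegral_map (by fun_prop) (by fun_prop)]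
    refine lintegral_congr fun z => ?_
    rw [← ofReal_norm, ENNReal.ofReal_pow (norm_nonneg _), hf, map_sub, map_one]
    simp only [sub_apply, one_apply_eq_self]
    congr 3
    abel
  rw [hcost]
  calc _ ≤ (ENNReal.ofReal (ρ ^ 2)) ^ (1 / 2 : ℝ) := by gcongr
    _ = ENNReal.ofReal ρ := by
      rw [ENNReal.ofReal_pow hρ, ← ENNReal.rpow_natCast, ← ENNReal.rpow_mul]
      norm_num

/-- The transportation cost of the linear map `γ (γ I - X)⁻¹` under `N(0, Sig)`. -/
noncomputable def transportCost (Sig X : Matrix (Fin p) (Fin p) ℝ) (γ : ℝ) : ℝ :=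
  ((γ • (γ • (1 : Matrix (Fin p) (Fin p) ℝ) - X)⁻¹ - 1) * Sig *
    (γ • (γ • (1 : Matrix (Fin p) (Fin p) ℝ) - X)⁻¹ - 1)ᵀ).trace

theorem transportCost_nonneg {Sig : Matrix (Fin p) (Fin p) ℝ} (hSig : Sig.PosSemidef)
    (X : Matrix (Fin p) (Fin p) ℝ) (γ : ℝ) : 0 ≤ transportCost Sig X γ := by
  have := (hSig.mul_mul_conjTranspose_same
    (γ • (γ • (1 : Matrix (Fin p) (Fin p) ℝ) - X)⁻¹ - 1)).trace_nonneg
  rwa [Matrix.conjTranspose_eq_transpose_of_trivial] at this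

/-- Intermediate value theorem in `t = 1/γ`: the map becomes `(1 - tX)⁻¹`, which is continuous down
to `t = 0`, where it is the identity and costs nothing. -/
theorem exists_transportCost_eq {Sig X : Matrix (Fin p) (Fin p) ℝ} {l γ₀ r : ℝ}
    (hD : ∀ γ, l < γ → (γ • (1 : Matrix (Fin p) (Fin p) ℝ) - X).PosDef) (hl : 0 < l)
    (hγ₀ : l < γ₀) (hr : 0 < r) (h : r ≤ transportCost Sig X γ₀) :
    ∃ γ, l < γ ∧ transportCost Sig X γ = r := by
  have h0 : 0 < γ₀ := hl.trans hγ₀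
  set c : ℝ → ℝ := fun t => (((1 - t • X)⁻¹ - 1) * Sig * ((1 - t • X)⁻¹ - 1)ᵀ).trace with hcdef
  have hdet : ∀ t : ℝ, 0 < t → (1 - t • X) = t • (t⁻¹ • (1 : Matrix (Fin p) (Fin p) ℝ) - X) := by
    intro t ht
    rw [smul_sub, smul_smul, mul_inv_cancel₀ ht.ne', one_smul]
  have hlt : ∀ t : ℝ, 0 < t → t ≤ γ₀⁻¹ → l < t⁻¹ := fun t ht hle =>
    hγ₀.trans_le ((le_inv_comm₀ ht h0).1 hle)
  have hc : ∀ t : ℝ, 0 < t → t ≤ γ₀⁻¹ → c t = transportCost Sig X t⁻¹ := by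
    intro t ht hle
    have hu := (Matrix.isUnit_iff_isUnit_det _).1 (hD _ (hlt t ht hle)).isUnit
    have := Matrix.inv_smul' (A := t⁻¹ • (1 : Matrix (Fin p) (Fin p) ℝ) - X)
      (Units.mk0 t ht.ne') hu
    simp only [Units.smul_def, Units.val_mk0, Units.val_inv_eq_inv_val] at this
    simp only [hcdef, transportCost, hdet t ht, this]
  have hcont : ContinuousOn c (Set.Icc 0 γ₀⁻¹) := by
    intro t ht
    refine ContinuousAt.continuousWithinAt ?_
    have hne : (1 - t • X).det ≠ 0 := by
      rcases ht.1.eq_or_lt with rfl | htpos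
      · simp
      · rw [hdet t htpos]
        exact (((hD _ (hlt t htpos ht.2)).smul htpos).det_pos).ne'
    have hinv : ContinuousAt (fun s : ℝ => (1 - s • X)⁻¹) t := by
      refine ContinuousAt.comp (g := Inv.inv) (f := fun s : ℝ => 1 - s • X) ?_ (by fun_prop)
      refine continuousAt_matrix_inv _ ?_
      rw [Ring.inverse_eq_inv']
      exact continuousAt_inv₀ hne
    have h1 : ContinuousAt (fun s : ℝ => (1 - s • X)⁻¹ - 1) t := hinv.sub continuousAt_const
    have hg : Continuous fun A : Matrix (Fin p) (Fin p) ℝ => (A * Sig * Aᵀ).trace := by fun_prop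
    exact hg.continuousAt.comp h1
  have hc0 : c 0 = 0 := by simp [hcdef]
  have hcγ : c γ₀⁻¹ = transportCost Sig X γ₀ := by
    rw [hc _ (inv_pos.2 h0) le_rfl, inv_inv]
  obtain ⟨t, ht, hct⟩ := intermediate_value_Icc (inv_pos.2 h0).le hcont
    (show r ∈ Set.Icc (c 0) (c γ₀⁻¹) from ⟨by rw [hc0]; exact hr.le, by rwa [hcγ]⟩)
  have htpos : 0 < t := by
    refine ht.1.lt_of_ne fun h => ?_
    rw [← h, hc0] at hct
    exact hr.ne hct
  exact ⟨t⁻¹, hlt t htpos ht.2, by rw [← hc t htpos ht.2, hct]⟩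

/-- Measures the duality gap: unused budget is charged at the price `γ`, and the noise `R` earns
back `Tr(RX)`. -/
theorem trace_mul_eq_dualValue {Sig X R : Matrix (Fin p) (Fin p) ℝ} {γ : ℝ} (ρ : ℝ)
    (hD : (γ • (1 : Matrix (Fin p) (Fin p) ℝ) - X).PosDef) :
    (((γ • (γ • (1 : Matrix (Fin p) (Fin p) ℝ) - X)⁻¹) * Sig *
      (γ • (γ • (1 : Matrix (Fin p) (Fin p) ℝ) - X)⁻¹)ᵀ + R) * X).trace
      = dualValue ρ Sig X γ - γ * (ρ ^ 2 - transportCost Sig X γ) + (R * X).trace := by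
  unfold dualValue transportCost
  set D := γ • (1 : Matrix (Fin p) (Fin p) ℝ) - X with hDdef
  have hX : X = γ • 1 - D := by rw [hDdef]; abel
  have hT : (D⁻¹)ᵀ = D⁻¹ := by simpa using hD.inv.isHermitian.eq
  have hDD : D⁻¹ * D = 1 :=
    Matrix.nonsing_inv_mul _ ((Matrix.isUnit_iff_isUnit_det _).1 hD.isUnit)
  rw [Matrix.add_mul, Matrix.trace_add]
  congr 1
  rw [hX]
  have hcomm : (D⁻¹ * Sig).trace = (Sig * D⁻¹).trace := Matrix.trace_mul_comm _ _
  have hm : D⁻¹ * Sig * D⁻¹ * D = D⁻¹ * Sig := by rw [mul_assoc, hDD, mul_one]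
  simp only [Matrix.transpose_smul, Matrix.transpose_sub, Matrix.transpose_one, hT, sub_mul,
    mul_sub, Matrix.smul_mul, Matrix.mul_smul, one_mul, mul_one, Matrix.trace_sub,
    Matrix.trace_smul, smul_eq_mul, hm, hcomm]
  ring

/-- Strong duality for the worst-case expectation over the ambiguity set, up to `ε`. -/
theorem exists_dualValue_sub_le (hp : 0 < p) {ρ : ℝ} (hρ : 0 < ρ)
    {Sig X : Matrix (Fin p) (Fin p) ℝ} (hSig : Sig.PosSemidef) (hX : X.PosDef) {ε : ℝ}
    (hε : 0 < ε) :
    ∃ γ : ℝ, (γ • (1 : Matrix (Fin p) (Fin p) ℝ) - X).PosDef ∧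
      ∃ S : Matrix (Fin p) (Fin p) ℝ, S.PosSemidef ∧
        wasserstein (multivariateGaussian 0 S) (multivariateGaussian 0 Sig)
          ≤ ENNReal.ofReal ρ ∧
        dualValue ρ Sig X γ - ε ≤ (S * X).trace := by
  obtain ⟨v, hv1, hv⟩ := exists_unit_isMax_quadratic hp X
  set l := v ⬝ᵥ X *ᵥ v with hl
  have hlpos : 0 < l := by
    have hv0 : v ≠ 0 := by rintro rfl; simp at hv1
    simpa using hX.dotProduct_mulVec_pos hv0
  have hD : ∀ γ, l < γ → (γ • (1 : Matrix (Fin p) (Fin p) ℝ) - X).PosDef :=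
    fun γ => posDef_smul_one_sub hX.isHermitian hv
  obtain ⟨γ, hγ, hle, hgap⟩ : ∃ γ, l < γ ∧ transportCost Sig X γ ≤ ρ ^ 2 ∧
      (γ - l) * (ρ ^ 2 - transportCost Sig X γ) ≤ ε := by
    by_cases hex : ∃ γ₀, l < γ₀ ∧ ρ ^ 2 ≤ transportCost Sig X γ₀
    · obtain ⟨γ₀, hγ₀, h⟩ := hex
      obtain ⟨γ, hγ, h⟩ := exists_transportCost_eq hD hlpos hγ₀ (by positivity) h
      exact ⟨γ, hγ, h.le, by rw [h, sub_self, mul_zero]; exact hε.le⟩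
    · push Not at hex
      -- The cost stays below `ρ²` for every `γ > l`, so `γ` may approach `l`; the leftover is at
      -- most `ρ²`, hence the offset `ε / ρ²`.
      have hγ : l < l + ε / ρ ^ 2 := lt_add_of_pos_right _ (by positivity)
      refine ⟨_, hγ, (hex _ hγ).le, ?_⟩
      calc (l + ε / ρ ^ 2 - l) * (ρ ^ 2 - transportCost Sig X (l + ε / ρ ^ 2))
          ≤ (l + ε / ρ ^ 2 - l) * ρ ^ 2 := by
            refine mul_le_mul_of_nonneg_left ?_ (by linarith)
            linarith [transportCost_nonneg hSig X (l + ε / ρ ^ 2)]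
        _ = ε := by rw [add_sub_cancel_left]; field_simp
  set T := γ • (γ • (1 : Matrix (Fin p) (Fin p) ℝ) - X)⁻¹ with hT
  -- The leftover budget becomes the variance of the noise along `v`, making the total cost exactly
  -- `ρ²`.
  set c := ρ ^ 2 - transportCost Sig X γ with hc
  have hR : (c • Matrix.vecMulVec v v).PosSemidef := by
    have := (Matrix.posSemidef_vecMulVec_self_star v).smul (sub_nonneg.2 hle)
    rwa [star_trivial] at this
  refine ⟨γ, hD γ hγ, T * Sig * Tᵀ + c • Matrix.vecMulVec v v, ?_, ?_, ?_⟩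
  · refine .add ?_ hR
    simpa using hSig.mul_mul_conjTranspose_same T
  · refine wasserstein_le_of_map hSig hR T hρ.le (le_of_eq ?_)
    rw [Matrix.trace_add, Matrix.trace_smul, Matrix.trace_vecMulVec, hv1]
    change transportCost Sig X γ + _ = _
    rw [smul_eq_mul, mul_one, hc]
    ring
  · rw [trace_mul_eq_dualValue ρ (hD γ hγ), Matrix.smul_mul, Matrix.trace_smul]
    have : (Matrix.vecMulVec v v * X).trace = l := by
      rw [hl, ← trace_transpose_vecMulVec_mul, Matrix.transpose_vecMulVec]
    rw [this, smul_eq_mul]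
    linarith

/-! ### Equality of the two objectives -/

theorem worstCase_le_dualValue (hp : 0 < p) {ρ : ℝ} (hρ : 0 ≤ ρ)
    {Sig X : Matrix (Fin p) (Fin p) ℝ} (hSig : Sig.PosSemidef) (hX : X.PosDef) {γ : ℝ}
    (hD : (γ • (1 : Matrix (Fin p) (Fin p) ℝ) - X).PosDef) :
    worstCase ρ Sig X ≤ dualValue ρ Sig X γ := by
  -- A diagonal entry, available since `p ≥ 1`, gives `γ > X₀₀ > 0`.
  have hγ : 0 ≤ γ := by
    have h1 := hX.diag_pos (i := ⟨0, hp⟩)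
    have h2 := hD.diag_pos (i := ⟨0, hp⟩)
    simp at h2
    linarith
  refine iSup₂_le ?_
  rintro _ ⟨⟨S, hS, rfl⟩, hW⟩
  simp_rw [trace_transpose_vecMulVec_mul]
  rw [integral_dotProduct_mulVec hS]
  exact_mod_cast trace_le_dualValue hS hSig hγ hρ hD hW

theorem droObjective_eq_sdpPartialValue (hp : 0 < p) {ρ : ℝ} (hρ : 0 < ρ)
    {Sig : Matrix (Fin p) (Fin p) ℝ} (hSig : Sig.PosSemidef)
    {𝒳 : Set (Matrix (Fin p) (Fin p) ℝ)} {X : Matrix (Fin p) (Fin p) ℝ} (hX : X.PosDef)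
    (hmem : X ∈ 𝒳) : droObjective ρ Sig X = sdpPartialValue ρ Sig 𝒳 X := by
  refine le_antisymm ?_ ?_
  · refine le_iInf fun Y => le_iInf fun γ => le_iInf fun h => ?_
    calc droObjective ρ Sig X
        ≤ ((-Real.log X.det : ℝ) : EReal) + (dualValue ρ Sig X γ : ℝ) :=
          add_le_add_right (worstCase_le_dualValue hp hρ.le hSig hX h.upper) _
      _ ≤ _ := by
        rw [← EReal.coe_add, EReal.coe_le_coe_iff, sdpObjective]
        linarith [dualValue_le_of_lmi ρ hSig h.upper h.lmi]
  -- Testing against real `z` above the objective keeps the `ε`-argument in real arithmetic.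
  · refine EReal.le_of_forall_lt_iff_le.1 fun z hz => ?_
    have key : ∀ ε : ℝ, 0 < ε → sdpPartialValue ρ Sig 𝒳 X ≤ ((z + ε : ℝ) : EReal) := by
      intro ε hε
      obtain ⟨γ, hD, S, hS, hW, hle⟩ := exists_dualValue_sub_le hp hρ hSig hX hε
      obtain ⟨Y, hY, hlmi, hYtr⟩ := exists_lmi_trace_eq ρ hSig hD
      have h1 : ((S * X).trace : EReal) ≤ worstCase ρ Sig X := by
        refine le_iSup₂_of_le (multivariateGaussian 0 S) ⟨⟨S, hS, rfl⟩, hW⟩ ?_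
        simp_rw [trace_transpose_vecMulVec_mul]
        rw [integral_dotProduct_mulVec hS]
      have h2 : ((-Real.log X.det + (S * X).trace : ℝ) : EReal) < z := by
        rw [EReal.coe_add]
        exact (add_le_add_right h1 _).trans_lt hz
      rw [EReal.coe_lt_coe_iff] at h2
      have h : SDPFeasible Sig 𝒳 X Y γ := ⟨hlmi, hD, hX, hY, hmem⟩
      rw [sdpPartialValue]
      refine iInf_le_of_le Y (iInf_le_of_le γ (iInf_le_of_le h ?_))
      rw [EReal.coe_le_coe_iff, sdpObjective]
      linarith
    refine EReal.le_of_forall_lt_iff_le.1 fun w hw => ?_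
    have := key (w - z) (sub_pos.2 (EReal.coe_lt_coe_iff.1 hw))
    rwa [add_sub_cancel] at this

end WassersteinDRO

theorem corollary2p8 {p : ℕ} (hp : 0 < p) {ρ : ℝ} (hρ : 0 < ρ)
    {Sig : Matrix (Fin p) (Fin p) ℝ} (hSig : Sig.PosSemidef)
    {𝒳 : Set (Matrix (Fin p) (Fin p) ℝ)} (h𝒳 : ∀ X ∈ 𝒳, X.PosDef) :
    WassersteinDRO.droValue ρ Sig 𝒳 = WassersteinDRO.sdpValue ρ Sig 𝒳 ∧
    (∀ X ∈ 𝒳, WassersteinDRO.droObjective ρ Sig X =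
      WassersteinDRO.sdpPartialValue ρ Sig 𝒳 X) := by
  have key : ∀ X ∈ 𝒳, WassersteinDRO.droObjective ρ Sig X =
      WassersteinDRO.sdpPartialValue ρ Sig 𝒳 X := fun X hX =>
    WassersteinDRO.droObjective_eq_sdpPartialValue hp hρ hSig (h𝒳 X hX) hX
  refine ⟨le_antisymm ?_ ?_, key⟩
  · refine le_iInf fun X => le_iInf fun Y => le_iInf fun γ => le_iInf fun h => ?_
    refine (iInf₂_le X h.mem).trans ?_
    rw [key X h.mem]
    exact iInf_le_of_le Y (iInf_le_of_le γ (iInf_le _ h))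
  · refine le_iInf₂ fun X hX => ?_
    rw [key X hX]
    exact iInf_le _ X
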